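/- Consider the control system $\dot{\mathbf x}=f(\mathbf x,u,d)$ with state $\mathbf x\in\mathbb R^n$, control values $u$ in a compact set $\mathcal U\subset\mathbb R^m$, disturbance values $d$ in a compact set $\mathcal D\subset\mathbb R^p$, and $f$ continuous. Let $[0,T]$ be the time horizon and $\mathcal L=\{\mathbf x: l(\mathbf x)\le 0\}$ the target set. Let $V$ be the value function, assumed differentiable on $\mathbb R^n\times[0,T]$: it solves the Hamilton–Jacobi–Isaacs variational inequality $$\min\{D_tV(\mathbf x,t)+H(\mathbf x,t),\; l(\mathbf x)-V(\mathbf x,t)\}=0\quad(0\le t<T),\qquad V(\mathbf x,T)=l(\mathbf x),$$ $$H(\mathbf x,t)=\min_{u\in\mathcal U}\max_{d\in\mathcal D}\nabla V(\mathbf x,t)\cdot f(\mathbf x,u,d).$$ The liveness backward reachable tube is $\mathrm{BRT}_{\rm live}(t)=\{\mathbf x: V(\mathbf x,t)\le 0\}$. A default liveness controller is any selection $\pi^*_{\rm live}(\mathbf x,t)\in\arg\min_{u\in\mathcal U}\max_{d\in\mathcal D}\nabla V(\mathbf x,t)\cdot f(\mathbf x,u,d)$, and $d^*(\mathbf x,t)\in\arg\max_{d\in\mathcal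 D}\nabla V(\mathbf x,t)\cdot f(\mathbf x,\pi^*_{\rm live}(\mathbf x,t),d)$ is an optimal (worst-case) disturbance. The set of live controls at $(\mathbf x,t)$ is $$\mathcal U_{\rm live}(\mathbf x,t)=\begin{cases}\mathcal U & V(\mathbf x,t)<0,\\ \{u\in\mathcal U: D_tV(\mathbf x,t)+\nabla V(\mathbf x,t)\cdot f(\mathbf x,u,d^*(\mathbf x,t))=0\} & V(\mathbf x,t)=0,\\ \emptyset & V(\mathbf x,t)>0.\end{cases}$$ Correspondingly, a control law $\mu:\mathbb R^n\times[0,T]\to\mathcal U$ is called live at $(\mathbf x,t)$ if there is $\epsilon>0$ with $t+\epsilon\le T$ such that the system driven by $u=\mu(\mathbf x(s),s)$ and $d=d^*(\mathbf x(s),s)$ has a (Carathéodory) trajectory from $(\mathbf x,t)$ on $[t,t+\epsilon]$, and $V(\xi(t+\delta),t+\delta)\le 0$ for all $\delta\in[0,\epsilon]$ and every trajectory $\xi$ from $(\mathbf x,t)$ that is defined at least on $[t,t+\delta]$. **Statement.** For every $t\in[0,T]$ and every $\mathbf x\in \mathrm{BRT}_{\rm live}(t)$ with $\mathbf x\notin\mathcal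 L$, $$\pi^*_{\rm live}(\mathbf x,t)\in\mathcal U_{\rm live}(\mathbf x,t).$$ Moreover, the control law $\pi^*_{\rm live}$ is live at $(\mathbf x,t)$ whenever the system driven by $\pi^*_{\rm live}$ and $d^*$ has a trajectory from $(\mathbf x,t)$ on some interval $[t,t+\epsilon]$, $\epsilon>0$. -/

import Mathlib

open Set MeasureTheory

noncomputable section

/-- A reach problem for the disturbed control system `x' = f(x, u, d)` with state in `ℝⁿ`, control
values in a compact set `U ⊆ ℝᵐ`, disturbance values in a compact set `D ⊆ ℝᵖ`, time horizon
`[0, T]` and target function `l` (the target set is its sub-zero level set). -/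
structure ReachProblem (n m p : ℕ) where
  f : EuclideanSpace ℝ (Fin n) → EuclideanSpace ℝ (Fin m) → EuclideanSpace ℝ (Fin p) →
    EuclideanSpace ℝ (Fin n)
  U : Set (EuclideanSpace ℝ (Fin m))
  D : Set (EuclideanSpace ℝ (Fin p))
  l : EuclideanSpace ℝ (Fin n) → ℝ
  T : ℝ
  continuous_f : Continuous fun q : EuclideanSpace ℝ (Fin n) × EuclideanSpace ℝ (Fin m) ×
    EuclideanSpace ℝ (Fin p) => f q.1 q.2.1 q.2.2
  isCompact_U : IsCompact U
  isCompact_D : IsCompact D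

namespace ReachProblem

variable {n m p : ℕ} (P : ReachProblem n m p)

/-- The target set `{x | l x ≤ 0}`. -/
def target : Set (EuclideanSpace ℝ (Fin n)) := {x | P.l x ≤ 0}

/-- The time derivative `D_t V(x, t)` (one-sided at the end points of the horizon `[0, T]`). -/
def timeDeriv (V : EuclideanSpace ℝ (Fin n) → ℝ → ℝ) (x : EuclideanSpace ℝ (Fin n)) (t : ℝ) : ℝ :=
  derivWithin (fun s => V x s) (Icc 0 P.T) t

/-- The directional term `∇V(x, t) · f(x, u, d)`. -/
def flowTerm (V : EuclideanSpace ℝ (Fin n) → ℝ → ℝ) (x : EuclideanSpace ℝ (Fin n)) (t : ℝ)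
    (u : EuclideanSpace ℝ (Fin m)) (d : EuclideanSpace ℝ (Fin p)) : ℝ :=
  inner ℝ (gradient (fun y => V y t) x) (P.f x u d)

/-- The worst case `max_{d ∈ D} ∇V(x, t) · f(x, u, d)` for the control value `u`. -/
def worstFlow (V : EuclideanSpace ℝ (Fin n) → ℝ → ℝ) (x : EuclideanSpace ℝ (Fin n)) (t : ℝ)
    (u : EuclideanSpace ℝ (Fin m)) : ℝ :=
  ⨆ d : P.D, P.flowTerm V x t u d

/-- The Hamiltonian `H(x, t) = min_{u ∈ U} max_{d ∈ D} ∇V(x, t) · f(x, u, d)`. -/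
def hamiltonian (V : EuclideanSpace ℝ (Fin n) → ℝ → ℝ) (x : EuclideanSpace ℝ (Fin n))
    (t : ℝ) : ℝ :=
  ⨅ u : P.U, P.worstFlow V x t u

/-- `V` is a differentiable value function on `ℝⁿ × [0, T]`: it solves the Hamilton-Jacobi-Isaacs
variational inequality `min {D_t V + H, l - V} = 0` with terminal condition `V(x, T) = l(x)`. -/
structure IsValueFunction (V : EuclideanSpace ℝ (Fin n) → ℝ → ℝ) : Prop where
  differentiableOn : DifferentiableOn ℝ (fun q : EuclideanSpace ℝ (Fin n) × ℝ => V q.1 q.2)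
    (univ ×ˢ Icc 0 P.T)
  hji : ∀ x, ∀ t ∈ Ico 0 P.T,
    min (P.timeDeriv V x t + P.hamiltonian V x t) (P.l x - V x t) = 0
  terminal : ∀ x, V x P.T = P.l x

/-- The liveness backward reachable tube at time `t`: the sub-zero level set of `V(·, t)`. -/
def brtLive (V : EuclideanSpace ℝ (Fin n) → ℝ → ℝ) (t : ℝ) : Set (EuclideanSpace ℝ (Fin n)) :=
  {x | V x t ≤ 0}

/-- `π` is a default liveness controller:
`π(x, t) ∈ argmin_{u ∈ U} max_{d ∈ D} ∇V(x, t) · f(x, u, d)`. -/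
def IsDefaultController (V : EuclideanSpace ℝ (Fin n) → ℝ → ℝ)
    (π : EuclideanSpace ℝ (Fin n) → ℝ → EuclideanSpace ℝ (Fin m)) : Prop :=
  ∀ x, ∀ t ∈ Icc 0 P.T, π x t ∈ P.U ∧ IsMinOn (P.worstFlow V x t) P.U (π x t)

/-- `d` is an optimal disturbance for the controller `π`:
`d(x, t) ∈ argmax_{d ∈ D} ∇V(x, t) · f(x, π(x, t), d)`. -/
def IsOptimalDisturbance (V : EuclideanSpace ℝ (Fin n) → ℝ → ℝ)
    (π : EuclideanSpace ℝ (Fin n) → ℝ → EuclideanSpace ℝ (Fin m))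
    (d : EuclideanSpace ℝ (Fin n) → ℝ → EuclideanSpace ℝ (Fin p)) : Prop :=
  ∀ x, ∀ t ∈ Icc 0 P.T, d x t ∈ P.D ∧ IsMaxOn (P.flowTerm V x t (π x t)) P.D (d x t)

/-- The set of live control values at `(x, t)` against the disturbance `d`: it is `U` if
`V(x, t) < 0`, it is `{u ∈ U | D_t V(x, t) + ∇V(x, t) · f(x, u, d(x, t)) = 0}` if `V(x, t) = 0`,
and it is empty if `V(x, t) > 0`. -/
def liveControls (V : EuclideanSpace ℝ (Fin n) → ℝ → ℝ)
    (d : EuclideanSpace ℝ (Fin n) → ℝ → EuclideanSpace ℝ (Fin p))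
    (x : EuclideanSpace ℝ (Fin n)) (t : ℝ) : Set (EuclideanSpace ℝ (Fin m)) :=
  {u | u ∈ P.U ∧
    (V x t < 0 ∨ (V x t = 0 ∧ P.timeDeriv V x t + P.flowTerm V x t u (d x t) = 0))}

/-- `ξ` is, on `[a, b]`, a (Carathéodory) trajectory from the state `x` at time `a` of the system
driven by the control law `μ` and the disturbance law `d`. -/
def IsTrajectory (μ : EuclideanSpace ℝ (Fin n) → ℝ → EuclideanSpace ℝ (Fin m))
    (d : EuclideanSpace ℝ (Fin n) → ℝ → EuclideanSpace ℝ (Fin p))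
    (x : EuclideanSpace ℝ (Fin n)) (a b : ℝ) (ξ : ℝ → EuclideanSpace ℝ (Fin n)) : Prop :=
  IntervalIntegrable (fun s => P.f (ξ s) (μ (ξ s) s) (d (ξ s) s)) volume a b ∧
    ∀ τ ∈ Icc a b, ξ τ = x + ∫ s in a..τ, P.f (ξ s) (μ (ξ s) s) (d (ξ s) s)

/-- The set of live control laws at `(x, t)` against the disturbance law `d`: the admissible laws
`μ` for which some `ε > 0` is such that the system driven by `μ` and `d` has a trajectory from
`(x, t)` on `[t, t + ε]`, and `V(ξ(t + δ), t + δ) ≤ 0` for all `δ ∈ [0, ε]` and every such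
trajectory `ξ` (also one that is only defined up to the time `t + δ`). -/
def liveControlLaws (V : EuclideanSpace ℝ (Fin n) → ℝ → ℝ)
    (d : EuclideanSpace ℝ (Fin n) → ℝ → EuclideanSpace ℝ (Fin p))
    (x : EuclideanSpace ℝ (Fin n)) (t : ℝ) :
    Set (EuclideanSpace ℝ (Fin n) → ℝ → EuclideanSpace ℝ (Fin m)) :=
  {μ | (∀ y, ∀ s ∈ Icc 0 P.T, μ y s ∈ P.U) ∧
    ∃ ε > 0, t + ε ≤ P.T ∧ (∃ ξ, P.IsTrajectory μ d x t (t + ε) ξ) ∧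
      ∀ δ ∈ Icc 0 ε, ∀ ξ, P.IsTrajectory μ d x t (t + δ) ξ → V (ξ (t + δ)) (t + δ) ≤ 0}

end ReachProblem

end

/-! Where `V < l`, the variational inequality forces `D_t V + H = 0`. As `π` attains the min and `d`
the max, this says that `V` has zero derivative along almost every point of a trajectory. At a point
of the tube outside the target, `V ≤ 0 < l`, so `V < l` persists nearby. A velocity bound keeps
every trajectory in that neighbourhood for a common short time, on which `V` is therefore constant,
hence `≤ 0`. The delicate point is constancy: `V` is only differentiable, not locally Lipschitz, so
absolute continuity of `V` along the trajectory is not at hand. It is still pointwise Lipschitz at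
every time, and `eq_of_isBigO_sub_of_ae_hasDerivWithinAt_zero` shows that this suffices. -/

open Filter Topology

/-! ### Constancy from an almost everywhere zero derivative -/

/-- A real function that is pointwise Lipschitz at every point of a null set maps it to a null
set. -/
theorem volume_image_eq_zero_of_isBigO_sub {g : ℝ → ℝ} {s : Set ℝ} (hs : volume s = 0)
    (hg : ∀ x ∈ s, (fun y => g y - g x) =O[𝓝[s] x] fun y => y - x) :
    volume (g '' s) = 0 := by
  -- On `E k j` the constant `k` works at scale `1 / (k + 1)`. The floor cuts the line into cells of
  -- that length, so any two points of one piece are close enough and `g` is Lipschitz there.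
  let E : ℕ → ℤ → Set ℝ := fun k j =>
    {x ∈ s | (∀ y ∈ s, |y - x| * (k + 1) < 1 → |g y - g x| ≤ k * |y - x|) ∧ ⌊x * (k + 1)⌋ = j}
  have hE : s ⊆ ⋃ k, ⋃ j, E k j := by
    intro x hx
    obtain ⟨c, hc⟩ := (hg x hx).bound
    obtain ⟨r, hr, hball⟩ := Metric.mem_nhdsWithin_iff.1 hc
    obtain ⟨k, hk⟩ := exists_nat_ge (max c r⁻¹)
    simp only [mem_iUnion]
    refine ⟨k, _, hx, fun y hy hyx => ?_, rfl⟩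
    have hyr : |y - x| < r := by
      have h1 : 1 ≤ r * k := by
        have := (inv_le_iff_one_le_mul₀ hr).1 ((le_max_right c r⁻¹).trans hk)
        linarith
      by_contra! hcon
      nlinarith [abs_nonneg (y - x), Nat.cast_nonneg (α := ℝ) k]
    have h2 : |g y - g x| ≤ c * |y - x| := hball ⟨by simpa [Real.dist_eq] using hyr, hy⟩
    exact h2.trans (mul_le_mul_of_nonneg_right ((le_max_left _ _).trans hk) (abs_nonneg _))
  have hlip : ∀ (k : ℕ) j, LipschitzOnWith (k : NNReal) g (E k j) := by
    intro k j
    refine LipschitzOnWith.of_dist_le_mul fun y hy x hx => ?_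
    have hk : (0 : ℝ) < k + 1 := by positivity
    have hfl := Int.abs_sub_lt_one_of_floor_eq_floor (hy.2.2.trans hx.2.2.symm)
    rw [← sub_mul, abs_mul, abs_of_pos hk] at hfl
    simpa [Real.dist_eq] using hx.2.1 y hy.1 hfl
  refine measure_mono_null (image_mono hE) ?_
  simp only [image_iUnion, measure_iUnion_null_iff]
  intro k j
  have h := (hlip k j).hausdorffMeasure_image_le zero_le_one
  have h0 : volume (E k j) = 0 := measure_mono_null (fun x hx => hx.1) hs
  rw [hausdorffMeasure_real, h0, mul_zero] at h
  exact nonpos_iff_eq_zero.1 h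

/-- A function on a compact interval that is pointwise Lipschitz everywhere and has zero derivative
almost everywhere takes the same value at both end points. -/
theorem eq_of_isBigO_sub_of_ae_hasDerivWithinAt_zero {g : ℝ → ℝ} {a b : ℝ} (hab : a ≤ b)
    (hg : ∀ s ∈ Icc a b, (fun y => g y - g s) =O[𝓝[Icc a b] s] fun y => y - s)
    (hg' : ∀ᵐ s, s ∈ Icc a b → HasDerivWithinAt g 0 (Icc a b) s) : g b = g a := by
  have hcont : ContinuousOn g (Icc a b) := by
    intro s hs
    have h0 : Tendsto (fun y => y - s) (𝓝[Icc a b] s) (𝓝 0) := by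
      have : Tendsto (fun y => y - s) (𝓝 s) (𝓝 (s - s)) := tendsto_id.sub_const s
      rw [sub_self] at this
      exact this.mono_left nhdsWithin_le_nhds
    exact tendsto_sub_nhds_zero_iff.1 ((hg s hs).trans_tendsto h0)
  set S := {s ∈ Icc a b | HasDerivWithinAt g 0 (Icc a b) s}
  -- One-dimensional Sard: the image of the critical points is null.
  have hcrit : volume (g '' S) = 0 := by
    refine addHaar_image_eq_zero_of_det_fderivWithin_eq_zero (f' := fun _ => 0) volume
      (fun s hs => ?_) (fun s _ => by simp [ContinuousLinearMap.det])
    have := (hs.2.mono (sep_subset _ _ : S ⊆ Icc a b)).hasFDerivWithinAt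
    rwa [ContinuousLinearMap.toSpanSingleton_zero] at this
  have hbad : volume (g '' (Icc a b \ S)) = 0 := by
    refine volume_image_eq_zero_of_isBigO_sub ?_
      fun s hs => (hg s hs.1).mono (nhdsWithin_mono _ sdiff_subset)
    refine measure_mono_null (fun s hs => ?_) (ae_iff.1 hg')
    exact fun h => hs.2 ⟨hs.1, h hs.1⟩
  -- By the intermediate value theorem, the null image contains the whole interval between the end
  -- values.
  have hnull : volume (uIcc (g a) (g b)) = 0 := by
    refine measure_mono_null (t := g '' S ∪ g '' (Icc a b \ S)) ?_ (measure_union_null hcrit hbad)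
    rw [← image_union, union_sdiff_cancel (fun s hs => hs.1), ← uIcc_of_le hab]
    exact intermediate_value_uIcc (by rwa [uIcc_of_le hab])
  rw [Real.volume_interval, ENNReal.ofReal_eq_zero] at hnull
  exact sub_eq_zero.1 (abs_nonpos_iff.1 hnull)

/-! ### The Hamilton–Jacobi–Isaacs equation and trajectories -/

namespace ReachProblem

variable {n m p : ℕ} {P : ReachProblem n m p} {V : EuclideanSpace ℝ (Fin n) → ℝ → ℝ}
  {π : EuclideanSpace ℝ (Fin n) → ℝ → EuclideanSpace ℝ (Fin m)}
  {d : EuclideanSpace ℝ (Fin n) → ℝ → EuclideanSpace ℝ (Fin p)}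

theorem hamiltonian_eq_flowTerm (hπ : P.IsDefaultController V π)
    (hd : P.IsOptimalDisturbance V π d) {t : ℝ} (ht : t ∈ Icc 0 P.T)
    (x : EuclideanSpace ℝ (Fin n)) :
    P.hamiltonian V x t = P.flowTerm V x t (π x t) (d x t) :=
  ((hπ x t ht).2.iInf_eq (hπ x t ht).1).trans ((hd x t ht).2.iSup_eq (hd x t ht).1)

theorem IsValueFunction.timeDeriv_add_flowTerm_eq_zero (hV : P.IsValueFunction V)
    (hπ : P.IsDefaultController V π) (hd : P.IsOptimalDisturbance V π d)
    {t : ℝ} (ht : t ∈ Ico 0 P.T) {x : EuclideanSpace ℝ (Fin n)} (hx : V x t < P.l x) :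
    P.timeDeriv V x t + P.flowTerm V x t (π x t) (d x t) = 0 := by
  rw [← hamiltonian_eq_flowTerm hπ hd (Ico_subset_Icc_self ht)]
  rcases min_eq_iff.1 (hV.hji x t ht) with h | h
  · exact h.1
  · exact absurd h.1 (sub_pos.2 hx).ne'

/-- Linearity of the joint derivative splits the space-time direction `(f, 1)` of a trajectory. That
`t < T` makes `[0, T]` nondegenerate, so the one-sided time derivative is unique. -/
theorem IsValueFunction.fderivWithin_apply (hV : P.IsValueFunction V) {t : ℝ}
    (ht : t ∈ Ico 0 P.T) (x : EuclideanSpace ℝ (Fin n)) (u : EuclideanSpace ℝ (Fin m))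
    (e : EuclideanSpace ℝ (Fin p)) :
    fderivWithin ℝ (fun q : EuclideanSpace ℝ (Fin n) × ℝ => V q.1 q.2) (univ ×ˢ Icc 0 P.T) (x, t)
      (P.f x u e, 1) = P.timeDeriv V x t + P.flowTerm V x t u e := by
  have htT := Ico_subset_Icc_self ht
  have hF := (hV.differentiableOn (x, t) ⟨mem_univ _, htT⟩).hasFDerivWithinAt
  set L := fderivWithin ℝ (fun q : EuclideanSpace ℝ (Fin n) × ℝ => V q.1 q.2)
    (univ ×ˢ Icc 0 P.T) (x, t)
  have h1 : P.timeDeriv V x t = L (0, 1) := by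
    have hc : HasDerivWithinAt (fun s : ℝ => (x, s)) (0, 1) (Icc 0 P.T) t :=
      (hasDerivWithinAt_const _ _ _).prodMk (hasDerivWithinAt_id _ _)
    exact (hF.comp_hasDerivWithinAt t hc fun s hs => ⟨mem_univ _, hs⟩).derivWithin
      (uniqueDiffOn_Icc (ht.1.trans_lt ht.2) t htT)
  have h2 : P.flowTerm V x t u e = L (P.f x u e, 0) := by
    have hc : HasFDerivAt (fun y => (y, t))
        (ContinuousLinearMap.inl ℝ (EuclideanSpace ℝ (Fin n)) ℝ) x :=
      hasFDerivAt_prodMk_left x t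
    have hmaps : MapsTo (fun y => (y, t)) univ
        ((univ : Set (EuclideanSpace ℝ (Fin n))) ×ˢ Icc 0 P.T) := fun y _ => ⟨mem_univ _, htT⟩
    have hc' := (hF.comp x hc.hasFDerivWithinAt hmaps).hasFDerivAt univ_mem
    have : fderiv ℝ (fun y => V y t) x = L.comp (ContinuousLinearMap.inl ℝ _ ℝ) := hc'.fderiv
    rw [flowTerm, gradient, InnerProductSpace.toDual_symm_apply, this]
    simp
  rw [h1, h2, ← map_add]
  simp

theorem IsTrajectory.continuousOn {x : EuclideanSpace ℝ (Fin n)} {a b : ℝ}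
    {ξ : ℝ → EuclideanSpace ℝ (Fin n)} (hab : a ≤ b) (h : P.IsTrajectory π d x a b ξ) :
    ContinuousOn ξ (Icc a b) := by
  have := intervalIntegral.continuousOn_primitive_interval' h.1 left_mem_uIcc
  rw [uIcc_of_le hab] at this
  exact (continuousOn_const.add this).congr h.2

theorem IsTrajectory.mono {x : EuclideanSpace ℝ (Fin n)} {a b c : ℝ}
    {ξ : ℝ → EuclideanSpace ℝ (Fin n)} (hab : a ≤ b) (hbc : b ≤ c)
    (h : P.IsTrajectory π d x a c ξ) : P.IsTrajectory π d x a b ξ :=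
  ⟨h.1.mono_set (by
    rw [uIcc_of_le hab, uIcc_of_le (hab.trans hbc)]; exact Icc_subset_Icc_right hbc),
    fun τ hτ => h.2 τ ⟨hτ.1, hτ.2.trans hbc⟩⟩

/-- A trajectory whose velocity is bounded by `M` in the ball of radius `r` around the initial state
does not leave this ball before the time `r / M`. -/
theorem IsTrajectory.norm_sub_lt {x : EuclideanSpace ℝ (Fin n)} {a b r M : ℝ}
    {ξ : ℝ → EuclideanSpace ℝ (Fin n)} (h : P.IsTrajectory π d x a b ξ) (hM : 0 ≤ M)
    (hr : M * (b - a) < r)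
    (hf : ∀ s ∈ Icc a b, ‖ξ s - x‖ < r → ‖P.f (ξ s) (π (ξ s) s) (d (ξ s) s)‖ ≤ M) :
    ∀ s ∈ Icc a b, ‖ξ s - x‖ < r := by
  intro s hs
  have hcont := h.continuousOn (hs.1.trans hs.2)
  by_contra! hcon
  have hcl : IsCompact (Icc a b ∩ (fun τ => ‖ξ τ - x‖) ⁻¹' Ici r) :=
    isCompact_Icc.of_isClosed_subset
      (((hcont.sub continuousOn_const).norm).preimage_isClosed_of_isClosed isClosed_Icc isClosed_Ici)
      inter_subset_left
  -- `τ` is the first exit time: the velocity bound holds strictly before it, and the single time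
  -- `τ` does not affect the integral.
  obtain ⟨τ, ⟨hτ, hτr⟩, hmin⟩ := hcl.exists_isLeast ⟨s, hs, hcon⟩
  have hint : ‖∫ σ in a..τ, P.f (ξ σ) (π (ξ σ) σ) (d (ξ σ) σ)‖ ≤ M * |τ - a| := by
    refine intervalIntegral.norm_integral_le_of_norm_le_const_ae ?_
    filter_upwards [Measure.ae_ne volume τ] with σ hστ hσ
    rw [uIoc_of_le hτ.1] at hσ
    have hσ' : σ ∈ Icc a b := ⟨hσ.1.le, hσ.2.trans hτ.2⟩
    refine hf σ hσ' ?_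
    by_contra! hc
    exact hστ (le_antisymm hσ.2 (hmin ⟨hσ', hc⟩))
  rw [← add_sub_cancel_left x (∫ σ in a..τ, _), ← h.2 τ hτ, abs_of_nonneg (sub_nonneg.2 hτ.1)]
    at hint
  have hle : M * (τ - a) ≤ M * (b - a) := by gcongr; exact hτ.2
  exact absurd (hτr.trans hint) (not_le.2 (hle.trans_lt hr))

theorem IsTrajectory.lipschitz {x : EuclideanSpace ℝ (Fin n)} {a b M : ℝ}
    {ξ : ℝ → EuclideanSpace ℝ (Fin n)} (h : P.IsTrajectory π d x a b ξ)
    (hf : ∀ s ∈ Icc a b, ‖P.f (ξ s) (π (ξ s) s) (d (ξ s) s)‖ ≤ M) :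
    ∀ s ∈ Icc a b, ∀ τ ∈ Icc a b, ‖ξ τ - ξ s‖ ≤ M * |τ - s| := by
  intro s hs τ hτ
  have hi : ∀ σ ∈ Icc a b, IntervalIntegrable (fun s => P.f (ξ s) (π (ξ s) s) (d (ξ s) s))
      volume a σ := fun σ hσ => (h.mono hσ.1 hσ.2).1
  rw [h.2 s hs, h.2 τ hτ, add_sub_add_left_eq_sub,
    intervalIntegral.integral_interval_sub_left (hi τ hτ) (hi s hs)]
  refine intervalIntegral.norm_integral_le_of_norm_le_const fun σ hσ => hf σ ?_
  exact uIcc_subset_Icc hs hτ (uIoc_subset_uIcc hσ)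

/-- Along a trajectory of the default controller against the optimal disturbance the value function
is constant as long as it stays below the target function and the velocity is bounded. -/
theorem IsValueFunction.eq_of_isTrajectory (hV : P.IsValueFunction V)
    (hπ : P.IsDefaultController V π) (hd : P.IsOptimalDisturbance V π d)
    {x : EuclideanSpace ℝ (Fin n)} {a b M : ℝ} {ξ : ℝ → EuclideanSpace ℝ (Fin n)} (hab : a ≤ b)
    (ha : 0 ≤ a) (hb : b < P.T) (h : P.IsTrajectory π d x a b ξ)
    (hf : ∀ s ∈ Icc a b, ‖P.f (ξ s) (π (ξ s) s) (d (ξ s) s)‖ ≤ M)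
    (hl : ∀ s ∈ Icc a b, V (ξ s) s < P.l (ξ s)) : V (ξ b) b = V (ξ a) a := by
  have hsub : ∀ s ∈ Icc a b, s ∈ Ico 0 P.T := fun s hs => ⟨ha.trans hs.1, hs.2.trans_lt hb⟩
  have hmaps : MapsTo (fun s => (ξ s, s)) (Icc a b)
      ((univ : Set (EuclideanSpace ℝ (Fin n))) ×ˢ Icc 0 P.T) :=
    fun s hs => ⟨mem_univ _, Ico_subset_Icc_self (hsub s hs)⟩
  have hF : ∀ s ∈ Icc a b, HasFDerivWithinAt (fun q : EuclideanSpace ℝ (Fin n) × ℝ => V q.1 q.2)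
      _ (univ ×ˢ Icc 0 P.T) (ξ s, s) :=
    fun s hs => (hV.differentiableOn _ (hmaps hs)).hasFDerivWithinAt
  refine eq_of_isBigO_sub_of_ae_hasDerivWithinAt_zero (g := fun s => V (ξ s) s) hab
    (fun s hs => ?_) ?_
  · have hcont : ContinuousWithinAt (fun s => (ξ s, s)) (Icc a b) s :=
      (h.continuousOn hab s hs).prodMk continuousWithinAt_id
    refine ((hF s hs).isBigO_sub.comp_tendsto (hcont.tendsto_nhdsWithin hmaps)).trans ?_
    -- In the sup norm of the product, `ξ` contributes slope `M` and time slope `1`.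
    refine Asymptotics.IsBigO.of_bound (max M 1) ?_
    filter_upwards [self_mem_nhdsWithin] with τ hτ
    have h1 := h.lipschitz hf s hs τ hτ
    simp only [Function.comp_apply, Prod.mk_sub_mk, Prod.norm_mk, Real.norm_eq_abs]
    refine max_le (h1.trans ?_) ?_
    · exact mul_le_mul_of_nonneg_right (le_max_left _ _) (abs_nonneg _)
    · exact le_mul_of_one_le_left (abs_nonneg _) (le_max_right _ _)
  -- Lebesgue differentiation gives the velocity of `ξ` almost everywhere; the chain rule then
  -- applies.
  · filter_upwards [h.1.ae_hasDerivAt_integral] with s hs' hs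
    have hξ : HasDerivWithinAt ξ (P.f (ξ s) (π (ξ s) s) (d (ξ s) s)) (Icc a b) s :=
      (((hs' (by rwa [uIcc_of_le hab]) a left_mem_uIcc).const_add x).hasDerivWithinAt).congr h.2
        (h.2 s hs)
    have := (hF s hs).comp_hasDerivWithinAt (f := fun s => (ξ s, s)) s (hξ.prodMk (hasDerivWithinAt_id s _)) hmaps
    rw [hV.fderivWithin_apply (hsub s hs),
      hV.timeDeriv_add_flowTerm_eq_zero hπ hd (hsub s hs) (hl s hs)] at this
    exact this

/-- Where the value function is below the target function, it is so on a neighbourhood. -/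
theorem IsValueFunction.exists_ball_lt (hV : P.IsValueFunction V) {t : ℝ} (ht : t ∈ Icc 0 P.T)
    {x : EuclideanSpace ℝ (Fin n)} (hx : V x t < P.l x) :
    ∃ r > 0, ∀ y s, s ∈ Icc 0 P.T → ‖y - x‖ < r → |s - t| < r → V y s < P.l y := by
  have hc := hV.differentiableOn.continuousOn
  -- Continuity of `l` is not assumed; it comes from `l = V(·, T)`.
  have hl : Continuous P.l := by
    have h : Continuous fun y => V y P.T := by
      refine hc.comp_continuous (f := fun y => (y, P.T)) (by fun_prop) fun y => ⟨mem_univ _, ?_⟩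
      exact right_mem_Icc.2 (ht.1.trans ht.2)
    exact h.congr hV.terminal
  have hev := ((hc (x, t) ⟨mem_univ _, ht⟩).eventually_lt
    (hl.comp continuous_fst).continuousWithinAt hx)
  obtain ⟨r, hr, hball⟩ := Metric.mem_nhdsWithin_iff.1 hev
  refine ⟨r, hr, fun y s hs hy hst => hball (a := (y, s)) ⟨?_, mem_univ _, hs⟩⟩
  rw [Metric.mem_ball, Prod.dist_eq, max_lt_iff, dist_eq_norm, Real.dist_eq]
  exact ⟨hy, hst⟩

theorem exists_norm_f_le (P : ReachProblem n m p) (x : EuclideanSpace ℝ (Fin n)) (r : ℝ) :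
    ∃ M > 0, ∀ y, ‖y - x‖ ≤ r → ∀ u ∈ P.U, ∀ e ∈ P.D, ‖P.f y u e‖ ≤ M := by
  obtain ⟨C, hC⟩ := ((isCompact_closedBall x r).prod
    (P.isCompact_U.prod P.isCompact_D)).exists_bound_of_continuousOn P.continuous_f.continuousOn
  refine ⟨max C 1, lt_max_of_lt_right one_pos, fun y hy u hu e he => ?_⟩
  exact (hC (y, u, e) ⟨mem_closedBall_iff_norm.2 hy, hu, he⟩).trans (le_max_left _ _)

end ReachProblem

/-! ### The main theorem -/

theorem mainTheorem2 {n m p : ℕ} (P : ReachProblem n m p)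
    (V : EuclideanSpace ℝ (Fin n) → ℝ → ℝ) (hV : P.IsValueFunction V)
    (π : EuclideanSpace ℝ (Fin n) → ℝ → EuclideanSpace ℝ (Fin m))
    (hπ : P.IsDefaultController V π)
    (d : EuclideanSpace ℝ (Fin n) → ℝ → EuclideanSpace ℝ (Fin p))
    (hd : P.IsOptimalDisturbance V π d)
    (t : ℝ) (ht : t ∈ Set.Icc 0 P.T)
    (x : EuclideanSpace ℝ (Fin n)) (hx : x ∈ ReachProblem.brtLive V t) (hxL : x ∉ P.target) :
    π x t ∈ P.liveControls V d x t ∧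
      ((∃ ε > 0, ∃ ξ, P.IsTrajectory π d x t (t + ε) ξ) → π ∈ P.liveControlLaws V d x t) := by
  have hVx : V x t ≤ 0 := hx
  have hlx : 0 < P.l x := not_le.1 hxL
  have htT : t < P.T := lt_of_le_of_ne ht.2 fun h => by
    rw [h, hV.terminal] at hVx
    exact hVx.not_gt hlx
  have hlt : V x t < P.l x := hVx.trans_lt hlx
  refine ⟨⟨(hπ x t ht).1, hVx.lt_or_eq.imp id fun h => ⟨h, ?_⟩⟩, ?_⟩
  · exact hV.timeDeriv_add_flowTerm_eq_zero hπ hd ⟨ht.1, htT⟩ hlt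
  rintro ⟨ε₀, hε₀, ξ₀, hξ₀⟩
  obtain ⟨r, hr, hball⟩ := hV.exists_ball_lt ht hlt
  obtain ⟨M, hM, hMf⟩ := P.exists_norm_f_le x r
  -- The four bounds restrict the given trajectory, keep times below `T`, keep times within `r` of
  -- `t`, and keep every trajectory in the `r`-ball. None depends on the trajectory tested later.
  obtain ⟨ε, hε, hε'⟩ := exists_between
    (show 0 < min (min ε₀ (P.T - t)) (min r (r / M)) from
      lt_min (lt_min hε₀ (sub_pos.2 htT)) (lt_min hr (div_pos hr hM)))
  obtain ⟨⟨h1, h2⟩, h3, h4⟩ : (ε < ε₀ ∧ ε < P.T - t) ∧ ε < r ∧ ε < r / M := by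
    simpa only [lt_min_iff] using hε'
  refine ⟨fun y s hs => (hπ y s hs).1, ε, hε, by linarith,
    ⟨ξ₀, hξ₀.mono (by linarith) (by linarith)⟩, fun δ hδ ξ hξ => ?_⟩
  have hab : t ≤ t + δ := by linarith [hδ.1]
  have hT : ∀ s ∈ Icc t (t + δ), s ∈ Icc 0 P.T := fun s hs =>
    ⟨ht.1.trans hs.1, by linarith [hs.2, hδ.2]⟩
  have hfM : ∀ s ∈ Icc t (t + δ), ‖ξ s - x‖ < r → ‖P.f (ξ s) (π (ξ s) s) (d (ξ s) s)‖ ≤ M :=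
    fun s hs hsr => hMf _ hsr.le _ (hπ _ s (hT s hs)).1 _ (hd _ s (hT s hs)).1
  have hMr : M * (t + δ - t) < r := by
    rw [lt_div_iff₀ hM] at h4
    nlinarith [hδ.2]
  have hnear := hξ.norm_sub_lt hM.le hMr hfM
  have hconst := hV.eq_of_isTrajectory hπ hd hab ht.1 (by linarith [hδ.2]) hξ
    (fun s hs => hfM s hs (hnear s hs)) fun s hs => hball _ s (hT s hs) (hnear s hs) (by
      rw [abs_of_nonneg (sub_nonneg.2 hs.1)]
      linarith [hs.2, hδ.2])
  have hξt : ξ t = x := by simpa using hξ.2 t (left_mem_Icc.2 hab)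
  rw [hconst, hξt]
  exact hVx
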